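/- Let $k$ be a local field of characteristic zero (archimedean or not); all topological $k$-vector spaces are locally convex. An (FN)-space is a nuclear Fréchet space, a (DFN)-space is a space isomorphic to the strong dual of an (FN)-space, and an analytic Tate space is a topological vector space $V$ that has a topological direct sum decomposition $V = L \oplus G$ with $L$ an (FN)-space and $G$ a (DFN)-space. A continuous linear map $f\colon E \to F$ is nuclear if $f(x) = \sum_n \lambda_n \ell_n(x) y_n$ for all $x$, where $(\ell_n)$ is an equicontinuous sequence of linear forms on $E$, $(y_n)$ lies in a Banach disc of $F$, and $\sum_n |\lambda_n| < \infty$ if $k$ is archimedean, resp. $\lambda_n \to 0$ if $k$ is non-archimedean. Two topological direct sum decompositions $V = V_+ \oplus V_- = W_+ \oplus W_-$ are called equivalent if for $\{i,j\} = \{+,-\}$ the compositions $V_i \hookrightarrow V \twoheadrightarrow W_j$ and $W_i \hookrightarrow V \twoheadrightarrow V_j$ (inclusions followed by the projections of the decompositions) are nuclear; a polarization of $V$ is an equivalence class of decompositions, and its members are called allowable. For a polarized space $V$, $GL(V)$ is the group of bicontinuous linear automorphisms of $V$, and $GL_{res}(V)$ consists of those $g \in GL(V)$ for which the components $g_{+,-}\colon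 V_+ \to V_-$ and $g_{-,+}\colon V_- \to V_+$ with respect to the allowable decompositions $V = V_+ \oplus V_-$ are nuclear. Let $V$ be an analytic Tate space. (i) If $V = V_+ \oplus V_- = W_+ \oplus W_-$ are two topological direct sum decompositions in which $V_+, W_+$ are (FN)-spaces and $V_-, W_-$ are (DFN)-spaces, then they are equivalent. Consequently there is exactly one polarization of $V$ that is the class of such a decomposition. (ii) With respect to this polarization, $GL(V) = GL_{res}(V)$. -/

import Mathlib

open Topology Filter Pointwise

noncomputable section

namespace AnalyticTate

universe u v w

/-- A local field of characteristic zero with its absolute value: a locally compact field of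
characteristic zero which is either non-archimedean, or `ℝ` or `ℂ` with the usual absolute value
(expressed by saying that the given normed field structure is that of an `RCLike` field; this
excludes such absolute values as `|x| ^ (1 / 2)` on `ℝ`). -/
structure IsLocalFieldCharZero (k : Type u) [inst : NontriviallyNormedField k] : Prop where
  charZero : CharZero k
  locallyCompact : LocallyCompactSpace k
  nonarch_or_arch : IsUltrametricDist k ∨
    ∃ r : RCLike k, r.toDenselyNormedField.toNontriviallyNormedField = inst

section Convexity

variable (k : Type u) [NontriviallyNormedField k]
variable {V : Type v} [AddCommGroup V] [Module k V]

/-- The seminorms of the theory of locally convex spaces over `k`: all seminorms if `k` is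
archimedean, those satisfying the strong triangle inequality if `k` is non-archimedean. -/
def IsConvexSeminorm (p : Seminorm k V) : Prop :=
  IsUltrametricDist k → ∀ x y : V, p (x + y) ≤ max (p x) (p y)

/-- Absolutely convex sets (discs): nonempty, and convex and balanced if `k` is archimedean,
resp. submodules over the ring of integers if `k` is non-archimedean. -/
def IsDisc (B : Set V) : Prop :=
  B.Nonempty ∧ ∀ x ∈ B, ∀ y ∈ B, ∀ a b : k,
    (‖a‖ + ‖b‖ ≤ 1 ∨ (IsUltrametricDist k ∧ ‖a‖ ≤ 1 ∧ ‖b‖ ≤ 1)) → a • x + b • y ∈ B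

variable (V) in
/-- The topology of `V` is locally convex: it is defined by the continuous (non-archimedean, if
`k` is) seminorms. -/
def IsLocallyConvex [TopologicalSpace V] : Prop :=
  ∀ U ∈ 𝓝 (0 : V), ∃ p : Seminorm k V,
    IsConvexSeminorm k p ∧ Continuous p ∧ {x | p x < 1} ⊆ U

/-- A Banach disc: a bounded disc `B` such that the span of `B`, normed by the gauge of `B`, is
complete. The sets `a • B`, `a ≠ 0`, form a basis of neighbourhoods of zero for the gauge. -/
structure IsBanachDisc [TopologicalSpace V] (B : Set V) : Prop where
  disc : IsDisc k B
  bounded : Bornology.IsVonNBounded k B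
  complete : ∀ s : ℕ → V, (∀ n, s n ∈ Submodule.span k B) →
    (∀ a : k, a ≠ 0 → ∃ N, ∀ m ≥ N, ∀ n ≥ N, s m - s n ∈ a • B) →
    ∃ x ∈ Submodule.span k B, ∀ a : k, a ≠ 0 → ∃ N, ∀ n ≥ N, s n - x ∈ a • B

end Convexity

section Nuclear

variable {k : Type u} [NontriviallyNormedField k]

/-- Nuclear maps: `f x = ∑ λₙ ℓₙ(x) yₙ` with `∑ λₙ` convergent, `(ℓₙ)` an equicontinuous sequence
of linear forms and `(yₙ)` a sequence in a Banach disc of the target. Unconditional convergence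
of `∑ λₙ` in `k` means `∑ |λₙ| < ∞` if `k` is archimedean and `λₙ → 0` if it is
non-archimedean, so that this is the usual definition in both cases. -/
def IsNuclearMap {V : Type v} [AddCommGroup V] [Module k V] [TopologicalSpace V]
    {W : Type w} [AddCommGroup W] [Module k W] [TopologicalSpace W] (f : V →L[k] W) : Prop :=
  ∃ (lam : ℕ → k) (l : ℕ → V →L[k] k) (y : ℕ → W) (B : Set W),
    Summable lam ∧ Equicontinuous (fun n => (l n : V → k)) ∧
    IsBanachDisc k B ∧ (∀ n, y n ∈ B) ∧
    ∀ x, HasSum (fun n => (lam n * l n x) • y n) (f x)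

variable {V : Type v} [AddCommGroup V] [Module k V]

/-- The space `V` endowed with the seminorm `p`. -/
def WithSeminorm (_p : Seminorm k V) : Type v := V

instance (p : Seminorm k V) : SeminormedAddCommGroup (WithSeminorm p) :=
  (p.toAddGroupSeminorm.toSeminormedAddCommGroup : SeminormedAddCommGroup V)

instance (p : Seminorm k V) : Module k (WithSeminorm p) :=
  inferInstanceAs (Module k V)

instance (p : Seminorm k V) : NormedSpace k (WithSeminorm p) where
  norm_smul_le a x := (map_smul_eq_mul p a x).le

/-- The Banach space attached to a seminorm `p` on `V`: the Hausdorff completion of `(V, p)`. -/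
abbrev LocalBanach (p : Seminorm k V) : Type v := UniformSpace.Completion (WithSeminorm p)

/-- The canonical map from `V` to the Banach space attached to `p`. -/
def toLocalBanach (p : Seminorm k V) (x : V) : LocalBanach p :=
  ((show WithSeminorm p from x : WithSeminorm p) : UniformSpace.Completion (WithSeminorm p))

variable (k V) in
/-- Nuclear spaces: for every continuous seminorm `p` there is a continuous seminorm `q ≥ p` such
that the canonical map from the Banach space of `q` to that of `p` (the unique continuous linear
map extending the identity of `V`) is nuclear. -/
def IsNuclearSpace [TopologicalSpace V] : Prop :=
  ∀ p : Seminorm k V, IsConvexSeminorm k p → Continuous p →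
    ∃ q : Seminorm k V, IsConvexSeminorm k q ∧ Continuous q ∧ p ≤ q ∧
      ∃ T : LocalBanach q →L[k] LocalBanach p,
        (∀ x : V, T (toLocalBanach q x) = toLocalBanach p x) ∧ IsNuclearMap T

end Nuclear

section Spaces

variable (k : Type u) [NontriviallyNormedField k]

/-- Nuclear Fréchet spaces. -/
structure IsFN (V : Type v) [AddCommGroup V] [Module k V] [TopologicalSpace V]
    [IsTopologicalAddGroup V] : Prop where
  continuousSMul : ContinuousSMul k V
  locallyConvex : IsLocallyConvex k V
  t2 : T2Space V
  firstCountable : FirstCountableTopology V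
  complete : @CompleteSpace V (IsTopologicalAddGroup.rightUniformSpace V)
  nuclear : IsNuclearSpace k V

/-- Spaces isomorphic to the strong dual of a nuclear Fréchet space. In Mathlib `StrongDual k F`
carries the topology of uniform convergence on bounded sets. -/
def IsDFN (V : Type v) [AddCommGroup V] [Module k V] [TopologicalSpace V] : Prop :=
  ∃ (F : Type (max u v)) (_ : AddCommGroup F) (_ : Module k F) (_ : TopologicalSpace F)
    (_ : IsTopologicalAddGroup F), IsFN k F ∧ Nonempty (V ≃L[k] StrongDual k F)

end Spaces

section Polarizations

variable (k : Type u) [NontriviallyNormedField k]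
variable (V : Type v) [AddCommGroup V] [Module k V] [TopologicalSpace V]

/-- A topological direct sum decomposition `V = V₊ ⊕ V₋`. -/
structure Decomposition where
  plus : Submodule k V
  minus : Submodule k V
  isTopCompl : Submodule.IsTopCompl plus minus

variable {k V} [IsTopologicalAddGroup V]

namespace Decomposition

/-- The projection `V ↠ V₊`. -/
def projPlus (D : Decomposition k V) : V →L[k] D.plus :=
  D.plus.projectionOntoL D.minus D.isTopCompl

/-- The projection `V ↠ V₋`. -/
def projMinus (D : Decomposition k V) : V →L[k] D.minus :=
  D.minus.projectionOntoL D.plus D.isTopCompl.symm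

/-- Equivalence of decompositions: for opposite signs `i`, `j` the compositions `Vᵢ ↪ V ↠ Wⱼ` and
`Wᵢ ↪ V ↠ Vⱼ` are nuclear. -/
def Equivalent (D E : Decomposition k V) : Prop :=
  IsNuclearMap (E.projMinus ∘L D.plus.subtypeL) ∧
  IsNuclearMap (E.projPlus ∘L D.minus.subtypeL) ∧
  IsNuclearMap (D.projMinus ∘L E.plus.subtypeL) ∧
  IsNuclearMap (D.projPlus ∘L E.minus.subtypeL)

/-- The equivalence class of a decomposition. Such a class is a polarization of `V`; its elements
are the allowable decompositions. -/
def polarization (D : Decomposition k V) : Set (Decomposition k V) :=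
  {E | D.Equivalent E}

/-- The decomposition has a nuclear Fréchet plus-summand and as minus-summand the strong dual of a
nuclear Fréchet space. -/
def IsTate (D : Decomposition k V) : Prop :=
  IsFN k D.plus ∧ IsDFN k D.minus

end Decomposition

/-- The restricted linear group of `V` with respect to a polarization: the bicontinuous
automorphisms `g` whose components `V₊ → V₋` and `V₋ → V₊` are nuclear for the allowable
decompositions `V = V₊ ⊕ V₋`. -/
def GLres (P : Set (Decomposition k V)) : Set (V ≃L[k] V) :=
  {g | ∀ D ∈ P,
    IsNuclearMap (D.projMinus ∘L (g : V →L[k] V) ∘L D.plus.subtypeL) ∧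
    IsNuclearMap (D.projPlus ∘L (g : V →L[k] V) ∘L D.minus.subtypeL)}

variable (k V) in
/-- Analytic Tate spaces. -/
def IsAnalyticTateSpace : Prop :=
  IsLocallyConvex k V ∧ ∃ D : Decomposition k V, D.IsTate

/-- The polarizations defined by an analytic Tate space structure. -/
def IsTatePolarization (P : Set (Decomposition k V)) : Prop :=
  ∃ D : Decomposition k V, D.IsTate ∧ P = D.polarization

end Polarizations

end AnalyticTate

end

noncomputable section

namespace AnalyticTate

section BanachDisc

variable {k : Type*} [NontriviallyNormedField k]
variable {V : Type*} [AddCommGroup V] [Module k V]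
variable {W : Type*} [AddCommGroup W] [Module k W]

theorem IsDisc.zero_mem {B : Set V} (hB : IsDisc k B) : (0 : V) ∈ B := by
  obtain ⟨x, hx⟩ := hB.1
  simpa using hB.2 x hx x hx 0 0 (by simp)

theorem IsDisc.smul_mem {B : Set V} (hB : IsDisc k B) {x : V} (hx : x ∈ B) {a : k}
    (ha : ‖a‖ ≤ 1) : a • x ∈ B := by
  simpa using hB.2 x hx x hx a 0 (by simp [ha])

theorem IsDisc.neg_mem {B : Set V} (hB : IsDisc k B) {x : V} (hx : x ∈ B) : -x ∈ B := by
  simpa using hB.smul_mem hx (a := -1) (by simp)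

theorem IsDisc.smul_set_mono {B : Set V} (hB : IsDisc k B) {a b : k} (hb : b ≠ 0)
    (hab : ‖a‖ ≤ ‖b‖) : a • B ⊆ b • B := by
  rintro _ ⟨x, hx, rfl⟩
  refine ⟨(b⁻¹ * a) • x, hB.smul_mem hx ?_, ?_⟩
  · rw [norm_mul, norm_inv, inv_mul_le_iff₀ (norm_pos_iff.2 hb), mul_one]
    exact hab
  · simp [smul_smul, hb]

theorem IsDisc.neg_mem_smul {B : Set V} (hB : IsDisc k B) {a : k} {x : V} (hx : x ∈ a • B) :
    -x ∈ a • B := by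
  obtain ⟨y, hy, rfl⟩ := hx
  exact ⟨-y, hB.neg_mem hy, by simp⟩

theorem IsDisc.add_mem_smul {B : Set V} (hB : IsDisc k B) {a c : k} (hc : ‖c‖ ≤ 1 / 2) {x y : V}
    (hx : x ∈ (a * c) • B) (hy : y ∈ (a * c) • B) : x + y ∈ a • B := by
  obtain ⟨x, hx, rfl⟩ := hx
  obtain ⟨y, hy, rfl⟩ := hy
  exact ⟨c • x + c • y, hB.2 x hx y hy c c (Or.inl (by linarith)), by simp [smul_smul]⟩

theorem IsDisc.image {B : Set V} (hB : IsDisc k B) (u : V →ₗ[k] W) : IsDisc k (u '' B) := by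
  refine ⟨hB.1.image u, ?_⟩
  rintro _ ⟨x, hx, rfl⟩ _ ⟨y, hy, rfl⟩ a b hab
  exact ⟨a • x + b • y, hB.2 x hx y hy a b hab, by simp⟩

theorem IsDisc.smul_geom_sum_mem {B : Set V} (hB : IsDisc k B) {c : k} (hc : ‖c‖ ≤ 1 / 2) (n : ℕ) :
    ∀ b : ℕ → V, (∀ i, b i ∈ B) → c • ∑ i ∈ Finset.range n, c ^ i • b i ∈ B := by
  induction n with
  | zero => intro b _; simpa using hB.zero_mem
  | succ n ih =>
    intro b hb
    have h := hB.2 _ (hb 0) _ (ih (fun i => b (i + 1)) fun i => hb _) c c (Or.inl (by linarith))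
    convert h using 1
    rw [Finset.sum_range_succ', add_comm, smul_add, Finset.smul_sum, Finset.smul_sum,
      Finset.smul_sum]
    simp [smul_smul, pow_succ']

/-- Completeness of the gauge of a disc passes to linear images. -/
theorem IsBanachDisc.image [TopologicalSpace V] [TopologicalSpace W] {B : Set V}
    (hB : IsBanachDisc k B) (u : V →L[k] W) : IsBanachDisc k (u '' B) := by
  have hd := hB.disc
  have hd' : IsDisc k (u '' B) := hd.image (u : V →ₗ[k] W)
  refine ⟨hd', hB.bounded.image u, fun s hs hcau => ?_⟩
  obtain ⟨c, hc0, hc⟩ := NormedField.exists_norm_lt k (r := 1 / 2) (by norm_num)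
  have hc1 : c ≠ 0 := norm_pos_iff.1 hc0
  have hc2 : ‖c‖ ≤ 1 / 2 := hc.le
  choose N hN using fun j : ℕ => hcau (c ^ j) (pow_ne_zero _ hc1)
  set M : ℕ → ℕ := fun j => j + ∑ i ∈ Finset.range (j + 1), N i with hM
  have hMj : ∀ j, j ≤ M j := fun j => Nat.le_add_right _ _
  have hMN : ∀ j, N j ≤ M j := fun j =>
    (Finset.single_le_sum (f := N) (fun _ _ => Nat.zero_le _)
      (Finset.self_mem_range_succ j)).trans (Nat.le_add_left _ _)
  have hMs : ∀ j, M j ≤ M (j + 1) := fun j => by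
    simp only [hM, Finset.sum_range_succ _ (j + 1)]; omega
  have hstep : ∀ j, ∃ b ∈ B, s (M (j + 1)) - s (M j) = u (c ^ j • b) := by
    intro j
    obtain ⟨_, ⟨b, hb, rfl⟩, h⟩ :=
      hN j (M (j + 1)) ((hMN j).trans (hMs j)) (M j) (hMN j)
    exact ⟨b, hb, by simpa using h.symm⟩
  choose b hb hbu using hstep
  have hspan : Submodule.span k (u '' B) = (Submodule.span k B).map (u : V →ₗ[k] W) :=
    (Submodule.map_span _ _).symm
  obtain ⟨w, hw, hwu⟩ : ∃ w ∈ Submodule.span k B, u w = s (M 0) := by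
    have := hs (M 0)
    rw [hspan] at this
    exact this
  set v : ℕ → V := fun j => w + ∑ i ∈ Finset.range j, c ^ i • b i with hv
  have hvu : ∀ j, u (v j) = s (M j) := by
    intro j
    induction j with
    | zero => simp [hv, hwu]
    | succ j ih =>
      have : v (j + 1) = v j + c ^ j • b j := by simp [hv, Finset.sum_range_succ, add_assoc]
      rw [this, map_add, ih, ← hbu]; abel
  have hvB : ∀ j, v j ∈ Submodule.span k B := fun j =>
    Submodule.add_mem _ hw (Submodule.sum_mem _ fun i _ =>
      Submodule.smul_mem _ _ (Submodule.subset_span (hb i)))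
  have hsmall : ∀ a : k, a ≠ 0 → ∃ n : ℕ, ‖c ^ n‖ ≤ ‖a‖ := by
    intro a ha
    obtain ⟨n, hn⟩ := exists_pow_lt_of_lt_one (norm_pos_iff.2 ha) (y := ‖c‖) (by linarith)
    exact ⟨n, by rw [norm_pow]; exact hn.le⟩
  have hdiff : ∀ n l, v (n + l) - v n ∈ (c ^ n * c⁻¹) • B := by
    intro n l
    refine ⟨_, hd.smul_geom_sum_mem hc2 l (fun i => b (n + i)) fun i => hb _, ?_⟩
    simp only [hv, Finset.sum_range_add, smul_smul, Finset.smul_sum, add_sub_add_left_eq_sub,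
      add_sub_cancel_left]
    refine Finset.sum_congr rfl fun i _ => ?_
    congr 1
    field_simp
    ring
  obtain ⟨x, hx, hxl⟩ := hB.complete v hvB (by
    intro a ha
    obtain ⟨n₀, hn₀⟩ := hsmall (a * c) (mul_ne_zero ha hc1)
    have key : ∀ n ≥ n₀, ∀ l, v (n + l) - v n ∈ a • B := by
      intro n hn l
      refine hd.smul_set_mono ha ?_ (hdiff n l)
      rw [norm_mul, norm_inv, mul_inv_le_iff₀ hc0, ← norm_mul]
      refine le_trans ?_ hn₀
      rw [norm_pow, norm_pow]
      exact pow_le_pow_of_le_one hc0.le (by linarith) hn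
    refine ⟨n₀, fun m hm n hn => ?_⟩
    rcases le_total n m with h | h
    · obtain ⟨l, rfl⟩ := Nat.exists_eq_add_of_le h
      exact key n hn l
    · obtain ⟨l, rfl⟩ := Nat.exists_eq_add_of_le h
      rw [← neg_sub]
      exact hd.neg_mem_smul (key m hm l))
  refine ⟨u x, by rw [hspan]; exact Submodule.mem_map_of_mem hx, fun a ha => ?_⟩
  have hac := mul_ne_zero ha hc1
  obtain ⟨N₁, hN₁⟩ := hcau (a * c) hac
  obtain ⟨N₂, hN₂⟩ := hxl (a * c) hac
  refine ⟨N₁, fun n hn => ?_⟩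
  have h1 := hN₁ n hn (M (max N₁ N₂)) ((le_max_left _ _).trans (hMj _))
  have h2 : u (v (max N₁ N₂) - x) ∈ (a * c) • (u '' B) := by
    obtain ⟨y, hy, hy'⟩ := hN₂ _ (le_max_right N₁ N₂)
    exact ⟨u y, ⟨y, hy, rfl⟩, by rw [← hy']; simp⟩
  have := hd'.add_mem_smul hc2 h1 h2
  rw [map_sub, hvu] at this
  simpa using this

theorem IsBanachDisc.prod [TopologicalSpace V] [TopologicalSpace W] {A : Set V} {B : Set W}
    (hA : IsBanachDisc k A) (hB : IsBanachDisc k B) : IsBanachDisc k (A ×ˢ B) := by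
  have hsmul : ∀ (a : k) (z : V × W), z ∈ a • (A ×ˢ B) ↔ z.1 ∈ a • A ∧ z.2 ∈ a • B := by
    rintro a ⟨x, y⟩
    constructor
    · rintro ⟨⟨x', y'⟩, ⟨hx, hy⟩, h⟩
      obtain ⟨rfl, rfl⟩ := Prod.mk.inj h
      exact ⟨⟨x', hx, rfl⟩, ⟨y', hy, rfl⟩⟩
    · rintro ⟨⟨x', hx, rfl⟩, ⟨y', hy, rfl⟩⟩
      exact ⟨(x', y'), ⟨hx, hy⟩, rfl⟩
  refine ⟨⟨hA.disc.1.prod hB.disc.1, ?_⟩, ?_, ?_⟩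
  · rintro ⟨x, y⟩ ⟨hx, hy⟩ ⟨x', y'⟩ ⟨hx', hy'⟩ a b hab
    exact ⟨hA.disc.2 x hx x' hx' a b hab, hB.disc.2 y hy y' hy' a b hab⟩
  · intro U hU
    rw [Prod.zero_eq_mk, nhds_prod_eq, mem_prod_iff] at hU
    obtain ⟨U₁, hU₁, U₂, hU₂, hU⟩ := hU
    filter_upwards [hA.bounded hU₁, hB.bounded hU₂] with a h₁ h₂
    rintro ⟨x, y⟩ ⟨hx, hy⟩
    obtain ⟨x', hx', rfl⟩ := h₁ hx
    obtain ⟨y', hy', rfl⟩ := h₂ hy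
    exact ⟨(x', y'), hU ⟨hx', hy'⟩, rfl⟩
  · intro s hs hcau
    have h1 : Submodule.span k (A ×ˢ B) ≤ (Submodule.span k A).prod (Submodule.span k B) :=
      Submodule.span_le.2 fun z hz =>
        ⟨Submodule.subset_span hz.1, Submodule.subset_span hz.2⟩
    have h2 : (Submodule.span k A).prod (Submodule.span k B) ≤ Submodule.span k (A ×ˢ B) := by
      rw [Submodule.prod_le_iff, Submodule.map_span, Submodule.map_span]
      constructor <;> refine Submodule.span_mono ?_
      · rintro _ ⟨x, hx, rfl⟩
        exact ⟨hx, hB.disc.zero_mem⟩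
      · rintro _ ⟨x, hx, rfl⟩
        exact ⟨hA.disc.zero_mem, hx⟩
    obtain ⟨x, hx, hxl⟩ := hA.complete (fun n => (s n).1) (fun n => (h1 (hs n)).1) (by
      intro a ha
      obtain ⟨N, hN⟩ := hcau a ha
      exact ⟨N, fun m hm n hn => ((hsmul _ _).1 (hN m hm n hn)).1⟩)
    obtain ⟨y, hy, hyl⟩ := hB.complete (fun n => (s n).2) (fun n => (h1 (hs n)).2) (by
      intro a ha
      obtain ⟨N, hN⟩ := hcau a ha
      exact ⟨N, fun m hm n hn => ((hsmul _ _).1 (hN m hm n hn)).2⟩)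
    refine ⟨(x, y), h2 ⟨hx, hy⟩, fun a ha => ?_⟩
    obtain ⟨N, hN⟩ := hxl a ha
    obtain ⟨N', hN'⟩ := hyl a ha
    exact ⟨max N N', fun n hn => (hsmul _ _).2
      ⟨hN n ((le_max_left _ _).trans hn), hN' n ((le_max_right _ _).trans hn)⟩⟩

theorem IsBanachDisc.add [TopologicalSpace V] [IsTopologicalAddGroup V] {A B : Set V}
    (hA : IsBanachDisc k A) (hB : IsBanachDisc k B) : IsBanachDisc k (A + B) := by
  have h := (hA.prod hB).image (ContinuousLinearMap.fst k V V + ContinuousLinearMap.snd k V V)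
  rwa [show A + B = _ from (Set.image_prod (· + ·)).symm]

end BanachDisc

section Ideal

variable {k : Type*} [NontriviallyNormedField k]
variable {V : Type*} [AddCommGroup V] [Module k V] [TopologicalSpace V]
variable {W : Type*} [AddCommGroup W] [Module k W] [TopologicalSpace W]
variable {X : Type*} [AddCommGroup X] [Module k X] [TopologicalSpace X]

theorem IsNuclearMap.comp_left {f : V →L[k] W} (hf : IsNuclearMap f) (u : W →L[k] X) :
    IsNuclearMap (u ∘L f) := by
  obtain ⟨lam, l, y, B, hlam, hl, hB, hy, hsum⟩ := hf
  refine ⟨lam, l, fun n => u (y n), u '' B, hlam, hl, hB.image u,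
    fun n => ⟨y n, hy n, rfl⟩, fun x => ?_⟩
  simpa [Function.comp_def] using (hsum x).map u u.continuous

theorem IsNuclearMap.comp_right {f : V →L[k] W} (hf : IsNuclearMap f) (u : X →L[k] V) :
    IsNuclearMap (f ∘L u) := by
  obtain ⟨lam, l, y, B, hlam, hl, hB, hy, hsum⟩ := hf
  refine ⟨lam, fun n => l n ∘L u, y, B, hlam, fun x U hU => ?_, hB, hy, fun x => hsum (u x)⟩
  exact u.continuous.continuousAt.eventually (hl (u x) U hU)

/-- A nuclear expansion may be indexed by any countable type. -/
theorem isNuclearMap_of_countable {ι : Type*} [Countable ι] {f : V →L[k] W} (lam : ι → k)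
    (l : ι → V →L[k] k) (y : ι → W) (B : Set W) (hlam : Summable lam)
    (hl : Equicontinuous (fun i => (l i : V → k))) (hB : IsBanachDisc k B) (hy : ∀ i, y i ∈ B)
    (hsum : ∀ x, HasSum (fun i => (lam i * l i x) • y i) (f x)) : IsNuclearMap f := by
  obtain ⟨e, he⟩ := exists_injective_nat ι
  have hout : ∀ n, n ∉ Set.range e → Function.extend e lam 0 n = 0 := fun n hn =>
    Function.extend_apply' _ _ _ hn
  refine ⟨Function.extend e lam 0, Function.extend e l 0, Function.extend e y 0, B, ?_, ?_, hB,
    fun n => ?_, fun x => ?_⟩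
  · rw [← he.summable_iff hout]
    simpa [Function.comp_def, he.extend_apply] using hlam
  · intro x U hU
    filter_upwards [hl x U hU] with z hz n
    by_cases hn : ∃ i, e i = n
    · obtain ⟨i, rfl⟩ := hn
      simpa [he.extend_apply] using hz i
    · simpa [Function.extend_apply' _ _ _ hn] using refl_mem_uniformity hU
  · by_cases hn : ∃ i, e i = n
    · obtain ⟨i, rfl⟩ := hn
      simpa [he.extend_apply] using hy i
    · simpa [Function.extend_apply' _ _ _ hn] using hB.disc.zero_mem
  · rw [← he.hasSum_iff (fun n hn => by simp [hout n hn])]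
    simpa [Function.comp_def, he.extend_apply] using hsum x

theorem IsNuclearMap.add [IsTopologicalAddGroup W] {f g : V →L[k] W} (hf : IsNuclearMap f)
    (hg : IsNuclearMap g) : IsNuclearMap (f + g) := by
  obtain ⟨lam, l, y, B, hlam, hl, hB, hy, hsum⟩ := hf
  obtain ⟨lam', l', y', B', hlam', hl', hB', hy', hsum'⟩ := hg
  refine isNuclearMap_of_countable (ι := ℕ ⊕ ℕ) (Sum.elim lam lam') (Sum.elim l l')
    (Sum.elim y y') (B + B') ?_ ?_ (hB.add hB') ?_ fun x => ?_
  · exact (HasSum.sum (f := Sum.elim lam lam') hlam.hasSum hlam'.hasSum).summable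
  · intro x U hU
    filter_upwards [hl x U hU, hl' x U hU] with z hz hz'
    rintro (n | n)
    exacts [hz n, hz' n]
  · rintro (n | n)
    · exact ⟨y n, hy n, 0, hB'.disc.zero_mem, by simp⟩
    · exact ⟨0, hB.disc.zero_mem, y' n, hy' n, by simp⟩
  · exact HasSum.sum (by simpa [Function.comp_def] using hsum x)
      (by simpa [Function.comp_def] using hsum' x)

end Ideal

section LocalBanach

variable {k : Type*} [NontriviallyNormedField k]
variable {E : Type*} [AddCommGroup E] [Module k E]

theorem norm_toLocalBanach (p : Seminorm k E) (x : E) : ‖toLocalBanach p x‖ = p x :=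
  UniformSpace.Completion.norm_coe _

theorem denseRange_toLocalBanach (p : Seminorm k E) : DenseRange (toLocalBanach p) :=
  UniformSpace.Completion.denseRange_coe (α := WithSeminorm p)

/-- The canonical map from `E` to the Banach space attached to `p`, as a linear map. -/
def toLocalBanachₗ (p : Seminorm k E) : E →ₗ[k] LocalBanach p where
  toFun := toLocalBanach p
  map_add' x y := UniformSpace.Completion.coe_add (α := WithSeminorm p) x y
  map_smul' a x := UniformSpace.Completion.coe_smul (X := WithSeminorm p) a x

@[simp]
theorem toLocalBanachₗ_apply (p : Seminorm k E) (x : E) :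
    toLocalBanachₗ p x = toLocalBanach p x := rfl

/-- The canonical map from `E` to the Banach space attached to a continuous seminorm. -/
def toLocalBanachL [TopologicalSpace E] [IsTopologicalAddGroup E] (p : Seminorm k E)
    (hp : Continuous p) : E →L[k] LocalBanach p where
  toLinearMap := toLocalBanachₗ p
  cont := by
    refine continuous_of_continuousAt_zero (toLocalBanachₗ p) ?_
    rw [ContinuousAt, map_zero, tendsto_zero_iff_norm_tendsto_zero]
    simp only [toLocalBanachₗ_apply, norm_toLocalBanach]
    simpa using hp.tendsto 0

/-- A continuous linear map which is bounded on a neighbourhood of zero is nuclear if its domain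
is nuclear and its target is complete. -/
theorem isNuclearMap_of_isNuclearSpace [TopologicalSpace E] [IsTopologicalAddGroup E]
    (hE : IsNuclearSpace k E) (hlc : IsLocallyConvex k E)
    {W : Type*} [AddCommGroup W] [Module k W] [UniformSpace W] [IsUniformAddGroup W]
    [ContinuousSMul k W] [CompleteSpace W] [T2Space W] (f : E →L[k] W) {U : Set E}
    (hU : U ∈ 𝓝 0) (hf : Bornology.IsVonNBounded k (f '' U)) : IsNuclearMap f := by
  obtain ⟨p, hpc, hp, hpU⟩ := hlc U hU
  obtain ⟨q, -, hq, -, T, hT, hTn⟩ := hE p hpc hp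
  let f₀ : WithSeminorm p →L[k] W := LinearMap.clmOfExistsBoundedImage (f : E →ₗ[k] W)
    ⟨Metric.ball 0 1, Metric.ball_mem_nhds _ one_pos, hf.subset <| Set.image_mono fun x hx => by
      rw [mem_ball_zero_iff] at hx
      exact hpU hx⟩
  let g : LocalBanach p →L[k] W := f₀.extend (UniformSpace.Completion.toComplL)
  have hg : ∀ x : E, g (toLocalBanach p x) = f x := fun x =>
    f₀.extend_eq (e := UniformSpace.Completion.toComplL)
      UniformSpace.Completion.denseRange_coe
      (UniformSpace.Completion.isUniformInducing_coe _) x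
  have : f = g ∘L T ∘L toLocalBanachL q hq := by
    ext x
    change f x = g (T (toLocalBanach q x))
    rw [hT, hg]
  rw [this]
  exact (hTn.comp_right _).comp_left g

end LocalBanach

section Bounded

variable {k : Type*} [NontriviallyNormedField k]
variable {E : Type*} [AddCommGroup E] [Module k E] [TopologicalSpace E]
variable {F : Type*} [AddCommGroup F] [Module k F] [TopologicalSpace F]

theorem IsFN.barrelledSpace [IsTopologicalAddGroup F] (hF : IsFN k F) : BarrelledSpace k F := by
  let _ : UniformSpace F := IsTopologicalAddGroup.rightUniformSpace F
  have : IsUniformAddGroup F := isUniformAddGroup_of_addCommGroup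
  have := hF.continuousSMul
  have := hF.firstCountable
  have := hF.complete
  have : (uniformity F).IsCountablyGenerated := IsUniformAddGroup.uniformity_countably_generated
  infer_instance

/-- A continuous linear map from a metrizable space to the strong dual of a Fréchet space is
bounded on a neighbourhood of zero. -/
theorem IsFN.exists_bounded_image_to_dual [IsTopologicalAddGroup F] [FirstCountableTopology E]
    (hF : IsFN k F)
    (f : E →L[k] StrongDual k F) :
    ∃ U ∈ 𝓝 (0 : E), Bornology.IsVonNBounded k (f '' U) := by
  have := hF.continuousSMul
  have := hF.firstCountable
  have := hF.barrelledSpace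
  obtain ⟨A, hA⟩ := (𝓝 (0 : E)).exists_antitone_basis
  obtain ⟨D, hD⟩ := (𝓝 (0 : F)).exists_antitone_basis
  obtain ⟨n, hn⟩ : ∃ n, ∀ x ∈ A n, ∀ v ∈ D n, ‖f x v‖ ≤ 1 := by
    by_contra! h
    choose x hx v hv hxv using h
    have hx0 : Tendsto x atTop (𝓝 0) := hA.tendsto hx
    have hv0 : Tendsto v atTop (𝓝 0) := hD.tendsto hv
    have hfx : ∀ w : F, Bornology.IsVonNBounded k (Set.range fun i => f (x i) w) := by
      intro w
      have h1 : Tendsto (fun i => f (x i)) atTop (𝓝 0) := by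
        simpa [Function.comp_def] using (f.continuous.tendsto 0).comp hx0
      have h2 : Tendsto (fun i => f (x i) w) atTop (𝓝 0) := by
        simpa [Function.comp_def] using ((continuous_eval_const w).tendsto (0 : StrongDual k F)).comp h1
      exact h2.isVonNBounded_range k
    let _ : UniformSpace F := IsTopologicalAddGroup.rightUniformSpace F
    have : IsUniformAddGroup F := isUniformAddGroup_of_addCommGroup
    have heq := (PolynormableSpace.banach_steinhaus (𝓕 := fun i => f (x i)) hfx).equicontinuous
    have h3 := heq 0 _ (Metric.dist_mem_uniformity one_pos)
    obtain ⟨i, hi⟩ := (hv0.eventually h3).exists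
    have h4 := hi i
    simp only [Function.comp, Set.mem_ofPred_eq, map_zero, dist_zero_left] at h4
    exact (hxv i).not_gt h4
  refine ⟨A n, hA.mem n, ContinuousLinearMap.isVonNBounded_iff.2 fun S hS => ?_⟩
  obtain ⟨c, hc, hc0⟩ := ((hS (hD.mem n)).and
    (Bornology.eventually_ne_cobounded (0 : k))).exists
  refine (NormedSpace.isVonNBounded_closedBall k k ‖c‖).subset ?_
  rintro _ ⟨_, ⟨x, hx, rfl⟩, w, hw, rfl⟩
  obtain ⟨w', hw', rfl⟩ := hc hw
  change f x (c • w') ∈ _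
  rw [mem_closedBall_zero_iff, map_smul, norm_smul]
  exact mul_le_of_le_one_right (norm_nonneg _) (hn x hx w' hw')

/-- A continuous linear map from the strong dual of a metrizable space to a metrizable space is
bounded on a neighbourhood of zero. -/
theorem exists_bounded_image_of_dual [FirstCountableTopology F] [ContinuousSMul k F]
    [FirstCountableTopology E] [ContinuousSMul k E] (f : StrongDual k F →L[k] E) :
    ∃ U ∈ 𝓝 (0 : StrongDual k F), Bornology.IsVonNBounded k (f '' U) := by
  obtain ⟨A, hA⟩ := (𝓝 (0 : E)).exists_antitone_basis
  obtain ⟨D, hD⟩ := (𝓝 (0 : F)).exists_antitone_basis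
  have hbasis := ContinuousLinearMap.hasBasis_nhds_zero_of_basis (σ := RingHom.id k) (E := F)
    (Metric.nhds_basis_ball (x := (0 : k)))
  have h1 : ∀ m, ∃ B : Set F, Bornology.IsVonNBounded k B ∧ ∃ ε : ℝ, 0 < ε ∧
      ∀ φ : StrongDual k F, (∀ v ∈ B, ‖φ v‖ < ε) → f φ ∈ A m := by
    intro m
    have : f ⁻¹' A m ∈ 𝓝 (0 : StrongDual k F) :=
      f.continuous.continuousAt.preimage_mem_nhds (by simpa using hA.mem m)
    obtain ⟨⟨B, ε⟩, ⟨hB, hε⟩, h⟩ := hbasis.mem_iff.1 this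
    exact ⟨B, hB, ε, hε, fun φ hφ => h fun v hv => by simpa using hφ v hv⟩
  choose B hB ε hε hBA using h1
  have h2 : ∀ m, ∃ c : k, c ≠ 0 ∧ B m ⊆ c • D m := fun m =>
    (((Bornology.eventually_ne_cobounded (0 : k)).and (hB m (hD.mem m)))).exists
  choose c hc hcB using h2
  set S : Set F := ⋃ m, (c m)⁻¹ • B m with hS
  have hSb : Bornology.IsVonNBounded k S := by
    refine (nhds_basis_balanced k F).isVonNBounded_iff.2 fun U hU => ?_
    obtain ⟨M, hM⟩ := hD.mem_iff.1 hU.1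
    have hsub : S ⊆ (⋃ m ∈ Finset.range M, (c m)⁻¹ • B m) ∪ U := by
      intro v hv
      obtain ⟨m, hm⟩ := Set.mem_iUnion.1 hv
      rcases lt_or_ge m M with h | h
      · exact Or.inl (Set.mem_biUnion (Finset.mem_coe.2 (Finset.mem_range.2 h)) hm)
      · right
        obtain ⟨w, hw, rfl⟩ := hm
        obtain ⟨w', hw', rfl⟩ := hcB m hw
        simp only [smul_smul, inv_mul_cancel₀ (hc m), one_smul]
        exact hM (hD.antitone h hw')
    refine Absorbs.mono_right ?_ hsub
    refine Absorbs.union ?_ hU.2.absorbs_self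
    rw [absorbs_biUnion_finset]
    intro m _
    exact ((hB m).image ((c m)⁻¹ • ContinuousLinearMap.id k F)) hU.1
  refine ⟨{φ | ∀ v ∈ S, φ v ∈ Metric.ball (0 : k) 1},
    hbasis.mem_of_mem (i := (S, 1)) ⟨hSb, one_pos⟩, ?_⟩
  refine (nhds_basis_balanced k E).isVonNBounded_iff.2 fun U hU => ?_
  obtain ⟨m, hm⟩ := hA.mem_iff.1 hU.1
  obtain ⟨d, hd0, hd⟩ := NormedField.exists_norm_lt k (r := ε m / ‖c m‖)
    (div_pos (hε m) (norm_pos_iff.2 (hc m)))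
  have hd1 : d ≠ 0 := norm_pos_iff.1 hd0
  filter_upwards [tendsto_norm_cobounded_atTop.eventually_ge_atTop ‖d⁻¹‖] with a ha
  refine subset_trans ?_ (hU.2.smul_mono ha)
  rintro _ ⟨φ, hφ, rfl⟩
  refine ⟨d • f φ, hm ?_, by simp [smul_smul, hd1]⟩
  rw [← map_smul]
  refine hBA m _ fun v hv => ?_
  have h3 : ‖φ ((c m)⁻¹ • v)‖ < 1 := by
    simpa using hφ _ (Set.mem_iUnion.2 ⟨m, v, hv, rfl⟩)
  rw [map_smul, norm_smul, norm_inv, inv_mul_lt_iff₀ (norm_pos_iff.2 (hc m)), mul_one] at h3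
  rw [smul_apply, norm_smul]
  rw [lt_div_iff₀ (norm_pos_iff.2 (hc m))] at hd
  exact lt_of_le_of_lt (mul_le_mul_of_nonneg_left h3.le (norm_nonneg _)) hd

end Bounded

section CoeffBound

variable {k : Type*} [NontriviallyNormedField k] {ι : Type*}

/-- The family `c` of scalars is bounded by `C` in the norm for which nuclear expansions over `k`
are measured: the sup norm if `k` is non-archimedean, the `ℓ¹`-norm otherwise. -/
def CoeffBound (c : ι → k) (C : ℝ) : Prop :=
  (IsUltrametricDist k → ∀ i, ‖c i‖ ≤ C) ∧
    (¬ IsUltrametricDist k → ∀ s : Finset ι, ∑ i ∈ s, ‖c i‖ ≤ C)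

theorem CoeffBound.mono {c : ι → k} {C D : ℝ} (h : CoeffBound c C) (hCD : C ≤ D) :
    CoeffBound c D :=
  ⟨fun hu i => (h.1 hu i).trans hCD, fun hu s => (h.2 hu s).trans hCD⟩

theorem CoeffBound.const_mul {c : ι → k} {C : ℝ} (h : CoeffBound c C) (a : k) :
    CoeffBound (fun i => a * c i) (‖a‖ * C) := by
  refine ⟨fun hu i => ?_, fun hu s => ?_⟩
  · rw [norm_mul]
    exact mul_le_mul_of_nonneg_left (h.1 hu i) (norm_nonneg _)
  · simp only [norm_mul, ← Finset.mul_sum]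
    exact mul_le_mul_of_nonneg_left (h.2 hu s) (norm_nonneg _)

theorem CoeffBound.comp {κ : Type*} {c : ι → k} {C : ℝ} (h : CoeffBound c C) {e : κ → ι}
    (he : Function.Injective e) : CoeffBound (fun j => c (e j)) C := by
  refine ⟨fun hu j => h.1 hu _, fun hu s => ?_⟩
  simpa using h.2 hu (s.map ⟨e, he⟩)

theorem coeffBound_const [Fintype ι] {t : k} {C : ℝ} (h : (Fintype.card ι : ℝ) * ‖t‖ ≤ C) :
    CoeffBound (fun _ : ι => t) C := by
  refine ⟨fun _ i => le_trans ?_ h, fun _ s => le_trans ?_ h⟩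
  · have : (1 : ℝ) ≤ Fintype.card ι := by exact_mod_cast Fintype.card_pos_iff.2 ⟨i⟩
    exact le_mul_of_one_le_left (norm_nonneg _) this
  · rw [Finset.sum_const, nsmul_eq_mul]
    exact mul_le_mul_of_nonneg_right (by exact_mod_cast Finset.card_le_univ s) (norm_nonneg _)

theorem CoeffBound.sumElim {κ : Type*} {c : ι → k} {d : κ → k} {C D : ℝ} (hC : 0 ≤ C) (hD : 0 ≤ D)
    (hc : CoeffBound c C) (hd : CoeffBound d D) : CoeffBound (Sum.elim c d) (C + D) := by
  refine ⟨fun hu => ?_, fun hu s => ?_⟩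
  · rintro (i | j)
    · exact (hc.1 hu i).trans (by linarith)
    · exact (hd.1 hu j).trans (by linarith)
  · rw [Finset.sum_sum_eq_sum_toLeft_add_sum_toRight]
    exact add_le_add (hc.2 hu _) (hd.2 hu _)

theorem IsConvexSeminorm.sum_le {V : Type*} [AddCommGroup V] [Module k V] {p : Seminorm k V}
    (hp : IsConvexSeminorm k p) {c : ι → k} {C D : ℝ} (hC : 0 ≤ C) (hc : CoeffBound c C)
    (hD : 0 ≤ D) (s : Finset ι) {v : ι → V} (hv : ∀ i ∈ s, p (v i) ≤ D) :
    p (∑ i ∈ s, c i • v i) ≤ C * D := by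
  by_cases hu : IsUltrametricDist k
  · refine Finset.sum_induction _ (fun w => p w ≤ C * D)
      (fun x y hx hy => (hp hu x y).trans (max_le hx hy)) (by simpa using mul_nonneg hC hD) ?_
    intro i hi
    rw [map_smul_eq_mul]
    exact mul_le_mul (hc.1 hu i) (hv i hi) (apply_nonneg _ _) hC
  · calc p (∑ i ∈ s, c i • v i) ≤ ∑ i ∈ s, p (c i • v i) :=
          Finset.le_sum_of_subadditive p (map_zero p).le (map_add_le_add p) _ _
      _ ≤ ∑ i ∈ s, ‖c i‖ * D := Finset.sum_le_sum fun i hi => by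
          rw [map_smul_eq_mul]
          exact mul_le_mul_of_nonneg_left (hv i hi) (norm_nonneg _)
      _ ≤ C * D := by
          rw [← Finset.sum_mul]
          exact mul_le_mul_of_nonneg_right (hc.2 hu s) hD

theorem IsLocalFieldCharZero.summable_norm (hk : IsLocalFieldCharZero k)
    (hu : ¬ IsUltrametricDist k) {c : ι → k} (hc : Summable c) : Summable fun i => ‖c i‖ := by
  obtain ⟨-, -, h | ⟨r, rfl⟩⟩ := hk
  · exact absurd h hu
  · exact hc.norm

theorem IsLocalFieldCharZero.completeSpace (hk : IsLocalFieldCharZero k) : CompleteSpace k := by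
  have := hk.locallyCompact
  have := ProperSpace.of_locallyCompactSpace k (E := k)
  infer_instance

open Classical in
theorem IsLocalFieldCharZero.exists_coeffBound_tail (hk : IsLocalFieldCharZero k) {c : ι → k}
    (hc : Summable c) {ε : ℝ} (hε : 0 < ε) :
    ∃ s : Finset ι, CoeffBound (fun i => if i ∈ s then 0 else c i) ε := by
  by_cases hu : IsUltrametricDist k
  · have h := hc.tendsto_cofinite_zero.eventually (Metric.ball_mem_nhds 0 hε)
    rw [Filter.eventually_cofinite] at h
    refine ⟨h.toFinset, fun _ i => ?_, fun h' => absurd hu h'⟩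
    dsimp only
    split_ifs with hi
    · simpa using hε.le
    · simpa using (not_not.1 fun h' => hi (h.mem_toFinset.2 h')).le
  · obtain ⟨s, hs⟩ := summable_iff_vanishing_norm.1 (hk.summable_norm hu hc) ε hε
    refine ⟨s, fun h' => absurd h' hu, fun _ t => ?_⟩
    have h1 := (le_abs_self _).trans (hs (t \ s) Finset.sdiff_disjoint).le
    refine le_trans (le_of_eq ?_) h1
    rw [← Finset.sum_subset (Finset.sdiff_subset (s := t) (t := s))]
    · exact Finset.sum_congr rfl fun i hi => by simp [(Finset.mem_sdiff.1 hi).2]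
    · intro i hi hi'
      have : i ∈ s := by simpa [hi] using hi'
      simp [this]

theorem IsLocalFieldCharZero.exists_coeffBound (hk : IsLocalFieldCharZero k) {c : ι → k}
    (hc : Summable c) : ∃ C, 0 ≤ C ∧ CoeffBound c C := by
  classical
  obtain ⟨s, hs⟩ := hk.exists_coeffBound_tail hc one_pos
  have h0 : 0 ≤ ∑ i ∈ s, ‖c i‖ := Finset.sum_nonneg fun _ _ => norm_nonneg _
  refine ⟨1 + ∑ i ∈ s, ‖c i‖, by positivity, fun hu i => ?_, fun hu t => ?_⟩
  · by_cases hi : i ∈ s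
    · have := Finset.single_le_sum (f := fun i => ‖c i‖) (fun _ _ => norm_nonneg _) hi
      linarith
    · have := hs.1 hu i
      simp only [hi, if_false] at this
      linarith
  · rw [← Finset.sum_sdiff (Finset.inter_subset_left (s₁ := t) (s₂ := s))]
    refine add_le_add ?_ ?_
    · refine le_trans (le_of_eq ?_) (hs.2 hu (t \ (t ∩ s)))
      refine Finset.sum_congr rfl fun i hi => ?_
      have : i ∉ s := fun h => by simp_all
      simp [this]
    · exact Finset.sum_le_sum_of_subset_of_nonneg Finset.inter_subset_right
        fun _ _ _ => norm_nonneg _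

theorem IsLocalFieldCharZero.summable_sigma (hk : IsLocalFieldCharZero k) {κ : ℕ → Type*}
    [∀ m, Fintype (κ m)] {c : (Σ m, κ m) → k} {a : ℕ → ℝ} (ha : Summable a)
    (hc : ∀ m, CoeffBound (fun i => c ⟨m, i⟩) (a m)) : Summable c := by
  have := hk.completeSpace
  by_cases hu : IsUltrametricDist k
  · refine NonarchimedeanAddGroup.summable_of_tendsto_cofinite_zero ?_
    rw [Metric.tendsto_nhds]
    intro ε hε
    have h := ha.tendsto_cofinite_zero.eventually (Metric.ball_mem_nhds 0 hε)
    rw [Filter.eventually_cofinite] at h ⊢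
    refine (h.toFinset.sigma fun m => (Finset.univ : Finset (κ m))).finite_toSet.subset ?_
    rintro ⟨m, i⟩ hi
    simp only [Finset.coe_sigma, Finset.coe_univ, Set.mem_sigma_iff, Set.mem_univ, and_true,
      Finset.mem_coe, Set.Finite.mem_toFinset]
    intro h'
    refine hi ?_
    rw [dist_zero_right]
    refine ((hc m).1 hu i).trans_lt ?_
    rw [dist_zero_right] at h'
    exact (le_abs_self _).trans_lt h'
  · refine Summable.of_norm ?_
    refine (summable_sigma_of_nonneg fun _ => norm_nonneg _).2
      ⟨fun m => (hasSum_fintype _).summable, ?_⟩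
    refine Summable.of_nonneg_of_le (fun m => tsum_nonneg fun _ => norm_nonneg _) (fun m => ?_) ha
    rw [tsum_fintype]
    exact (hc m).2 hu Finset.univ

end CoeffBound

section Approximation

variable {k : Type*} [NontriviallyNormedField k]
variable {L : Type*} [AddCommGroup L] [Module k L] [TopologicalSpace L]

/-- Up to an error small relative to `q`, the seminorm `p` sees the identity of `L` as a map of
finite rank whose nuclear expansions have coefficients among `lam` and functionals among `l`. -/
structure IsFiniteRankApprox (p q : Seminorm k L) (lam : ℕ → k) (l : ℕ → L →L[k] k) : Prop where
  summable : Summable lam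
  norm_le : ∀ n z, ‖l n z‖ ≤ q z
  approx : ∀ ε : ℝ, 0 < ε → ∃ (N : ℕ) (y : ℕ → L), (∀ n, p (y n) ≤ 1) ∧
    ∀ z, p (z - ∑ n ∈ Finset.range N, (lam n * l n z) • y n) ≤ ε * q z

theorem IsFiniteRankApprox.mono {p p' q : Seminorm k L} {lam : ℕ → k} {l : ℕ → L →L[k] k}
    (h : IsFiniteRankApprox p q lam l) (hp : p' ≤ p) : IsFiniteRankApprox p' q lam l where
  summable := h.summable
  norm_le := h.norm_le
  approx ε hε := by
    obtain ⟨N, y, hy, hN⟩ := h.approx ε hε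
    exact ⟨N, y, fun n => (hp _).trans (hy n), fun z => (hp _).trans (hN z)⟩

theorem isConvexSeminorm_normSeminorm_localBanach {V : Type*} [AddCommGroup V] [Module k V]
    {p : Seminorm k V} (hp : IsConvexSeminorm k p) :
    IsConvexSeminorm k (normSeminorm k (LocalBanach p)) := by
  intro hu x y
  simp only [coe_normSeminorm]
  refine (denseRange_toLocalBanach p).induction_on₂ (p := fun x y : LocalBanach p =>
    ‖x + y‖ ≤ max ‖x‖ ‖y‖) ?_ ?_ x y
  · exact isClosed_le (by fun_prop) (by fun_prop)
  · intro x y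
    rw [show toLocalBanach p x + toLocalBanach p y = toLocalBanach p (x + y) from
      ((toLocalBanachₗ p).map_add x y).symm]
    simpa only [norm_toLocalBanach] using hp hu x y

theorem IsNuclearSpace.exists_isFiniteRankApprox [IsTopologicalAddGroup L]
    (hk : IsLocalFieldCharZero k) (hL : IsNuclearSpace k L) {p : Seminorm k L}
    (hpc : IsConvexSeminorm k p) (hp : Continuous p) :
    ∃ q : Seminorm k L, IsConvexSeminorm k q ∧ Continuous q ∧ p ≤ q ∧
      ∃ lam l, IsFiniteRankApprox p q lam l := by
  classical
  obtain ⟨q, hqc, hq, hpq, T, hT, lam₀, l₀, y₀, B, hlam₀, hl₀, hB, hy₀, hsum₀⟩ := hL p hpc hp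
  obtain ⟨R, hR⟩ : ∃ R, ∀ y ∈ B, ‖y‖ ≤ R :=
    isBounded_iff_forall_norm_le.1 (NormedSpace.isVonNBounded_iff k |>.1 hB.bounded)
  obtain ⟨C, hC⟩ : ∃ C, ∀ n x, ‖l₀ n x‖ ≤ C * ‖x‖ :=
    ((NormedSpace.equicontinuous_TFAE l₀).out 1 3).1 hl₀
  obtain ⟨a, ha⟩ := NormedField.exists_lt_norm k (max C 0)
  obtain ⟨b, hb⟩ := NormedField.exists_lt_norm k (max (2 * R) 0)
  have ha0 : 0 < ‖a‖ := (le_max_right _ _).trans_lt ha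
  have hb0 : 0 < ‖b‖ := (le_max_right _ _).trans_lt hb
  have ha1 : a ≠ 0 := norm_pos_iff.1 ha0
  have hb1 : b ≠ 0 := norm_pos_iff.1 hb0
  set lam : ℕ → k := fun n => (a * b) * lam₀ n with hlam
  set l : ℕ → L →L[k] k := fun n => a⁻¹ • (l₀ n ∘L toLocalBanachL q hq) with hl
  set y₁ : ℕ → LocalBanach p := fun n => b⁻¹ • y₀ n with hy₁
  have hls : Summable lam := hlam₀.mul_left _
  have hlq : ∀ n z, ‖l n z‖ ≤ q z := by
    intro n z
    have h1 : ‖l₀ n (toLocalBanach q z)‖ ≤ ‖a‖ * q z := by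
      refine (hC n _).trans ?_
      rw [norm_toLocalBanach]
      exact mul_le_mul_of_nonneg_right ((le_max_left _ _).trans ha.le) (apply_nonneg _ _)
    change ‖a⁻¹ * l₀ n (toLocalBanach q z)‖ ≤ q z
    rw [norm_mul, norm_inv, inv_mul_le_iff₀ ha0]
    exact h1
  have hy₁n : ∀ n, ‖y₁ n‖ ≤ 1 / 2 := by
    intro n
    rw [hy₁, norm_smul, norm_inv, inv_mul_le_iff₀ hb0]
    have := hR _ (hy₀ n)
    have := (le_max_left _ _).trans hb.le
    linarith
  have hsum : ∀ z, HasSum (fun n => lam n • (l n z • y₁ n)) (toLocalBanach p z) := by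
    intro z
    have h := hsum₀ (toLocalBanach q z)
    rw [hT] at h
    convert h using 2 with n
    change ((a * b) * lam₀ n) • ((a⁻¹ * l₀ n (toLocalBanach q z)) • b⁻¹ • y₀ n) = _
    simp only [smul_smul]
    congr 1
    field_simp
  have hconv := isConvexSeminorm_normSeminorm_localBanach hpc
  have hvn : ∀ (z : L) (n : ℕ), ‖l n z • y₁ n‖ ≤ q z := by
    intro z n
    rw [norm_smul]
    have := mul_le_mul (hlq n z) (hy₁n n) (norm_nonneg _) (apply_nonneg q z)
    have := apply_nonneg q z
    linarith
  obtain ⟨Λ, hΛ0, hΛ⟩ := hk.exists_coeffBound hls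
  refine ⟨q, hqc, hq, hpq, lam, l, hls, hlq, fun ε hε => ?_⟩
  obtain ⟨s₀, hs₀⟩ := hk.exists_coeffBound_tail hls (half_pos hε)
  obtain ⟨N, hN⟩ := s₀.exists_nat_subset_range
  have htail : ∀ z, ‖toLocalBanach p z - ∑ n ∈ Finset.range N, lam n • (l n z • y₁ n)‖
      ≤ ε / 2 * q z := by
    intro z
    have hlim := ((hsum z).sub_const
      (∑ n ∈ Finset.range N, lam n • (l n z • y₁ n))).norm
    refine le_of_tendsto hlim ?_
    filter_upwards [eventually_ge_atTop (Finset.range N)] with s hs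
    rw [← Finset.sum_sdiff hs, add_sub_cancel_right]
    have h1 := hconv.sum_le (half_pos hε).le hs₀ (apply_nonneg q z) (s \ Finset.range N)
      (v := fun n => l n z • y₁ n) fun n _ => hvn z n
    refine le_trans (le_of_eq ?_) h1
    rw [coe_normSeminorm]
    congr 1
    refine Finset.sum_congr rfl fun n hn => ?_
    rw [if_neg fun h => (Finset.mem_sdiff.1 hn).2 (hN h)]
  set δ : ℝ := min (1 / 2) (ε / (2 * (Λ + 1))) with hδ
  have hδ0 : 0 < δ := by positivity
  have hδΛ : Λ * δ ≤ ε / 2 := by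
    have h1 : δ ≤ ε / (2 * (Λ + 1)) := min_le_right _ _
    have h2 : (Λ + 1) * δ ≤ ε / 2 := by
      calc (Λ + 1) * δ ≤ (Λ + 1) * (ε / (2 * (Λ + 1))) :=
            mul_le_mul_of_nonneg_left h1 (by positivity)
        _ = ε / 2 := by field_simp
    linarith
  have hyd : ∀ n, ∃ y : L, ‖y₁ n - toLocalBanach p y‖ < δ := fun n => by
    simpa [dist_eq_norm] using (denseRange_toLocalBanach p).exists_dist_lt (y₁ n) hδ0
  choose y hy using hyd
  refine ⟨N, y, fun n => ?_, fun z => ?_⟩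
  · rw [← norm_toLocalBanach]
    have h1 : ‖toLocalBanach p (y n)‖ ≤ ‖y₁ n‖ + ‖y₁ n - toLocalBanach p (y n)‖ := by
      rw [norm_sub_rev]; exact norm_le_norm_add_norm_sub' _ _
    have h2 : δ ≤ 1 / 2 := min_le_left _ _
    linarith [hy n, hy₁n n]
  · have h1 : toLocalBanach p (z - ∑ n ∈ Finset.range N, (lam n * l n z) • y n) =
        (toLocalBanach p z - ∑ n ∈ Finset.range N, lam n • (l n z • y₁ n)) +
        ∑ n ∈ Finset.range N, lam n • (l n z • (y₁ n - toLocalBanach p (y n))) := by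
      simp only [← toLocalBanachₗ_apply, map_sub, map_sum, map_smul, smul_sub,
        Finset.sum_sub_distrib, smul_smul]
      abel
    have h2 := hconv.sum_le hΛ0 hΛ (D := q z * δ) (mul_nonneg (apply_nonneg _ _) hδ0.le)
      (Finset.range N) (v := fun n => l n z • (y₁ n - toLocalBanach p (y n))) fun n _ => by
        rw [coe_normSeminorm, norm_smul]
        exact mul_le_mul (hlq n z) (hy n).le (norm_nonneg _) (apply_nonneg _ _)
    rw [coe_normSeminorm] at h2
    rw [← norm_toLocalBanach, h1]
    refine (norm_add_le _ _).trans ?_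
    have h3 : Λ * (q z * δ) ≤ ε / 2 * q z := by
      calc Λ * (q z * δ) = (Λ * δ) * q z := by ring
        _ ≤ ε / 2 * q z := mul_le_mul_of_nonneg_right hδΛ (apply_nonneg _ _)
    linarith [htail z]

/-- The topology of a nuclear Fréchet space is defined by an increasing sequence of seminorms with
finite rank approximations between successive terms. -/
theorem IsFN.exists_seminorm_seq [IsTopologicalAddGroup L] (hk : IsLocalFieldCharZero k)
    (hL : IsFN k L) :
    ∃ (p : ℕ → Seminorm k L) (lam : ℕ → ℕ → k) (l : ℕ → ℕ → L →L[k] k),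
      (∀ m, IsConvexSeminorm k (p m)) ∧ (∀ m, Continuous (p m)) ∧ Monotone p ∧
      (∀ U ∈ 𝓝 (0 : L), ∃ m, {x | p m x < 1} ⊆ U) ∧
      ∀ m, IsFiniteRankApprox (p m) (p (m + 1)) (lam m) (l m) := by
  have := hL.firstCountable
  obtain ⟨A, hA⟩ := (𝓝 (0 : L)).exists_antitone_basis
  choose r hrc hr hrA using fun n => hL.locallyConvex (A n) (hA.mem n)
  let S := {p : Seminorm k L // IsConvexSeminorm k p ∧ Continuous p}
  have step : ∀ (n : ℕ) (p : S), ∃ q : S, p.1 ≤ q.1 ∧ r n ≤ q.1 ∧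
      ∃ lam l, IsFiniteRankApprox p.1 q.1 lam l := by
    rintro n ⟨p, hpc, hp⟩
    have hc : IsConvexSeminorm k (p ⊔ r n) := fun hu x y => by
      simp only [Seminorm.sup_apply]
      refine max_le ((hpc hu x y).trans ?_) ((hrc n hu x y).trans ?_)
      · exact max_le_max (le_max_left _ _) (le_max_left _ _)
      · exact max_le_max (le_max_right _ _) (le_max_right _ _)
    have hcont : Continuous (p ⊔ r n : Seminorm k L) := by
      rw [Seminorm.coe_sup]; exact hp.sup (hr n)
    obtain ⟨q, hqc, hq, hpq, lam, l, h⟩ := hL.nuclear.exists_isFiniteRankApprox hk hc hcont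
    exact ⟨⟨q, hqc, hq⟩, le_sup_left.trans hpq, le_sup_right.trans hpq, lam, l,
      h.mono le_sup_left⟩
  choose g hg₁ hg₂ lam l hg₃ using step
  let P : ℕ → S := fun m => Nat.rec ⟨r 0, hrc 0, hr 0⟩ (fun n p => g n p) m
  refine ⟨fun m => (P m).1, fun m => lam m (P m), fun m => l m (P m), fun m => (P m).2.1,
    fun m => (P m).2.2, monotone_nat_of_le_succ fun m => hg₁ m (P m), fun U hU => ?_,
    fun m => hg₃ m (P m)⟩
  obtain ⟨m, hm⟩ := hA.mem_iff.1 hU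
  exact ⟨m + 1, fun x hx => hm (hrA m (lt_of_le_of_lt (hg₂ m (P m) x) hx))⟩

end Approximation

section FiniteExpansion

variable {k : Type*} [NontriviallyNormedField k]
variable {E : Type*} [AddCommGroup E] [Module k E] [TopologicalSpace E]
variable {L : Type*} [AddCommGroup L] [Module k L] [TopologicalSpace L]

/-- `h` is of finite rank, given by functionals which are bounded on `U`. -/
def HasFiniteRankOn (U : Set E) (h : E →L[k] L) : Prop :=
  ∃ (N : ℕ) (a : Fin N → E →L[k] k) (z : Fin N → L),
    (∀ j, ∃ D, ∀ e ∈ U, ‖a j e‖ ≤ D) ∧ ∀ e, h e = ∑ j, a j e • z j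

/-- `h` has a finite nuclear expansion with coefficients bounded by `C`, functionals bounded by
one on `U`, and vectors in the unit ball of `p`. -/
def HasFiniteExpansion (U : Set E) (p : Seminorm k L) (C : ℝ) (h : E →L[k] L) : Prop :=
  ∃ (ι : Type) (_ : Fintype ι) (c : ι → k) (x : ι → E →L[k] k) (y : ι → L),
    CoeffBound c C ∧ (∀ i, ∀ e ∈ U, ‖x i e‖ ≤ 1) ∧ (∀ i, p (y i) ≤ 1) ∧
    ∀ e, h e = ∑ i, (c i * x i e) • y i

theorem HasFiniteRankOn.exists_seminorm_le {U : Set E} {h : E →L[k] L} (hh : HasFiniteRankOn U h)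
    (p : Seminorm k L) : ∃ C, ∀ e ∈ U, p (h e) ≤ C := by
  obtain ⟨N, a, z, ha, hz⟩ := hh
  choose D hD using ha
  refine ⟨∑ j, D j * p (z j), fun e he => ?_⟩
  rw [hz]
  refine (Finset.le_sum_of_subadditive p (map_zero p).le (map_add_le_add p) _ _).trans ?_
  refine Finset.sum_le_sum fun j _ => ?_
  rw [map_smul_eq_mul]
  exact mul_le_mul_of_nonneg_right (hD j e he) (apply_nonneg _ _)

/-- Finite rank approximation of a map bounded on `U`. -/
theorem IsFiniteRankApprox.exists_hasFiniteRankOn [IsTopologicalAddGroup L] [ContinuousSMul k L]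
    {p q : Seminorm k L} {lam : ℕ → k}
    {l : ℕ → L →L[k] k} (H : IsFiniteRankApprox p q lam l) {U : Set E} (r : E →L[k] L) {C : ℝ}
    (hr : ∀ e ∈ U, q (r e) ≤ C) {ε : ℝ} (hε : 0 < ε) :
    ∃ h : E →L[k] L, HasFiniteRankOn U h ∧ ∀ e ∈ U, p (r e - h e) ≤ ε := by
  have hC : 0 < |C| + 1 := by positivity
  obtain ⟨N, y, -, hy⟩ := H.approx (ε / (|C| + 1)) (div_pos hε hC)
  refine ⟨∑ j : Fin N, (lam j • (l j ∘L r)).smulRight (y j),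
    ⟨N, fun j => lam j • (l j ∘L r), fun j => y j, fun j => ⟨‖lam j‖ * C, fun e he => ?_⟩,
      fun e => by simp⟩, fun e he => ?_⟩
  · rw [smul_apply, norm_smul]
    exact mul_le_mul_of_nonneg_left ((H.norm_le _ _).trans (hr e he)) (norm_nonneg _)
  · have h1 := hy (r e)
    rw [Finset.sum_range fun n => (lam n * l n (r e)) • y n] at h1
    simp only [sum_apply, ContinuousLinearMap.smulRight_apply, smul_apply,
      ContinuousLinearMap.comp_apply, smul_eq_mul]
    refine h1.trans ?_
    rw [div_mul_eq_mul_div, div_le_iff₀ hC]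
    refine mul_le_mul_of_nonneg_left ?_ hε.le
    exact (hr e he).trans ((le_abs_self C).trans (by linarith))

/-- A map of finite rank which is small for the seminorm `q` has an expansion with small
coefficients for the seminorm `p`. -/
theorem IsFiniteRankApprox.hasFiniteExpansion {p q : Seminorm k L} {lam : ℕ → k}
    {l : ℕ → L →L[k] k} (H : IsFiniteRankApprox p q lam l) {Λ : ℝ} (hΛ0 : 0 ≤ Λ)
    (hΛ : CoeffBound lam Λ) {U : Set E} {h : E →L[k] L} (hh : HasFiniteRankOn U h) {μ : k}
    (hμ : μ ≠ 0) (hle : ∀ e ∈ U, q (h e) ≤ ‖μ‖) :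
    HasFiniteExpansion U p (‖μ‖ * (Λ + 1)) h := by
  obtain ⟨J, a, z, ha, hz⟩ := hh
  have hμ0 := norm_pos_iff.2 hμ
  choose D hD using ha
  obtain ⟨d, hd⟩ := NormedField.exists_lt_norm k (∑ j, |D j|)
  have hd0 : 0 < ‖d‖ := (Finset.sum_nonneg fun _ _ => abs_nonneg _).trans_lt hd
  have hd1 : d ≠ 0 := norm_pos_iff.1 hd0
  have hDd : ∀ j, D j ≤ ‖d‖ := fun j => (le_abs_self _).trans
    ((Finset.single_le_sum (f := fun j => |D j|) (fun _ _ => abs_nonneg _)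
      (Finset.mem_univ j)).trans hd.le)
  obtain ⟨t, ht0, ht⟩ := NormedField.exists_norm_lt k (r := ‖μ‖ / (J + 1)) (by positivity)
  have ht1 : t ≠ 0 := norm_pos_iff.1 ht0
  set Q : ℝ := ∑ j, q (z j) with hQ
  have hQ0 : 0 ≤ Q := Finset.sum_nonneg fun _ _ => apply_nonneg _ _
  have hzQ : ∀ j, q (z j) ≤ Q := fun j =>
    Finset.single_le_sum (f := fun j => q (z j)) (fun _ _ => apply_nonneg _ _) (Finset.mem_univ j)
  obtain ⟨N, y, hy1, hy⟩ := H.approx (‖t‖ / (‖d‖ * (Q + 1))) (by positivity)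
  set w : Fin J → L := fun j => z j - ∑ n ∈ Finset.range N, (lam n * l n (z j)) • y n with hw
  refine ⟨Fin N ⊕ Fin J, inferInstance,
    Sum.elim (fun n => μ * lam n) (fun _ => t),
    Sum.elim (fun n => μ⁻¹ • (l n ∘L h)) (fun j => d⁻¹ • a j),
    Sum.elim (fun n => y n) (fun j => (t⁻¹ * d) • w j), ?_, ?_, ?_, ?_⟩
  · rw [mul_add, mul_one]
    refine CoeffBound.sumElim (by positivity) hμ0.le
      ((hΛ.comp Fin.val_injective).const_mul μ) (coeffBound_const ?_)
    rw [Fintype.card_fin]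
    rw [lt_div_iff₀ (by positivity)] at ht
    linarith
  · rintro (n | j) e he
    · simp only [Sum.elim_inl, smul_apply, norm_smul, norm_inv]
      rw [inv_mul_le_iff₀ hμ0, mul_one]
      exact (H.norm_le _ _).trans (hle e he)
    · simp only [Sum.elim_inr, smul_apply, norm_smul, norm_inv]
      rw [inv_mul_le_iff₀ hd0, mul_one]
      exact (hD j e he).trans (hDd j)
  · rintro (n | j)
    · exact hy1 n
    · rw [Sum.elim_inr, map_smul_eq_mul, norm_mul, norm_inv]
      have h1 : p (w j) ≤ ‖t‖ / (‖d‖ * (Q + 1)) * (Q + 1) :=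
        (hy (z j)).trans (mul_le_mul_of_nonneg_left ((hzQ j).trans (by linarith)) (by positivity))
      calc ‖t‖⁻¹ * ‖d‖ * p (w j)
          ≤ ‖t‖⁻¹ * ‖d‖ * (‖t‖ / (‖d‖ * (Q + 1)) * (Q + 1)) :=
            mul_le_mul_of_nonneg_left h1 (by positivity)
        _ = 1 := by field_simp
  · intro e
    rw [Fintype.sum_sum_type]
    simp only [Sum.elim_inl, Sum.elim_inr, smul_apply, smul_eq_mul,
      ContinuousLinearMap.comp_apply, smul_smul]
    have h1 : ∀ n : Fin N, (μ * lam n * (μ⁻¹ * l n (h e))) • y n =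
        ∑ j, a j e • (lam n * l n (z j)) • y n := by
      intro n
      rw [show μ * lam n * (μ⁻¹ * l n (h e)) = lam n * l n (h e) by field_simp, hz,
        map_sum, Finset.mul_sum, Finset.sum_smul]
      refine Finset.sum_congr rfl fun j _ => ?_
      rw [map_smul, smul_smul, smul_eq_mul]
      ring_nf
    have h2 : ∀ j, (t * (d⁻¹ * a j e) * (t⁻¹ * d)) • w j = a j e • w j := by
      intro j
      congr 1
      field_simp
    simp only [h1, h2]
    rw [hz, Finset.sum_comm, ← Finset.sum_add_distrib]
    refine Finset.sum_congr rfl fun j _ => ?_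
    rw [← Finset.smul_sum, ← smul_add, hw]
    dsimp only
    rw [Finset.sum_range fun n => (lam n * l n (z j)) • y n]
    simp

end FiniteExpansion

section SeminormSeq

variable {k : Type*} [NontriviallyNormedField k]
variable {L : Type*} [AddCommGroup L] [Module k L] [TopologicalSpace L]

/-- In a complete space whose topology is defined by the seminorms `p m`, the intersections of
balls of all the `p m` are Banach discs. -/
theorem isBanachDisc_of_seminorm_seq [IsTopologicalAddGroup L] [ContinuousSMul k L]
    (hcomplete : @CompleteSpace L (IsTopologicalAddGroup.rightUniformSpace L))
    {p : ℕ → Seminorm k L} (hpc : ∀ m, IsConvexSeminorm k (p m)) (hp : ∀ m, Continuous (p m))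
    (hbasis : ∀ U ∈ 𝓝 (0 : L), ∃ m, {x | p m x < 1} ⊆ U) {C : ℕ → ℝ} (hC : ∀ m, 0 ≤ C m) :
    IsBanachDisc k {x : L | ∀ m, p m x ≤ C m} := by
  set B : Set L := {x : L | ∀ m, p m x ≤ C m} with hB
  have hsmul : ∀ {a : k}, a ≠ 0 → ∀ {x : L}, x ∈ a • B ↔ ∀ m, p m x ≤ ‖a‖ * C m := by
    intro a ha x
    rw [Set.mem_smul_set_iff_inv_smul_mem₀ ha]
    refine forall_congr' fun m => ?_
    rw [map_smul_eq_mul, norm_inv, inv_mul_le_iff₀ (norm_pos_iff.2 ha)]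
  have hbdd : Bornology.IsVonNBounded k B := by
    intro U hU
    obtain ⟨m, hm⟩ := hbasis U hU
    filter_upwards [tendsto_norm_cobounded_atTop.eventually_gt_atTop (C m)] with a ha x hx
    have ha0 : 0 < ‖a‖ := (hC m).trans_lt ha
    rw [Set.mem_smul_set_iff_inv_smul_mem₀ (norm_pos_iff.1 ha0)]
    refine hm ?_
    change p m (a⁻¹ • x) < 1
    rw [map_smul_eq_mul, norm_inv, inv_mul_lt_iff₀ ha0, mul_one]
    exact (hx m).trans_lt ha
  refine ⟨⟨⟨0, fun m => by simpa using hC m⟩, ?_⟩, hbdd, ?_⟩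
  · intro x hx y hy a b hab m
    have h1 : p m (a • x) ≤ ‖a‖ * C m := by
      rw [map_smul_eq_mul]
      exact mul_le_mul_of_nonneg_left (hx m) (norm_nonneg _)
    have h2 : p m (b • y) ≤ ‖b‖ * C m := by
      rw [map_smul_eq_mul]
      exact mul_le_mul_of_nonneg_left (hy m) (norm_nonneg _)
    rcases hab with hab | ⟨hu, ha, hb⟩
    · refine (map_add_le_add (p m) _ _).trans ((add_le_add h1 h2).trans ?_)
      rw [← add_mul]
      exact mul_le_of_le_one_left (hC m) hab
    · exact (hpc m hu _ _).trans (max_le (h1.trans (mul_le_of_le_one_left (hC m) ha))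
        (h2.trans (mul_le_of_le_one_left (hC m) hb)))
  · intro s hs hcau
    let _ : UniformSpace L := IsTopologicalAddGroup.rightUniformSpace L
    have : IsUniformAddGroup L := isUniformAddGroup_of_addCommGroup
    have hcs : CauchySeq s := by
      rw [cauchySeq_iff]
      intro V hV
      rw [uniformity_eq_comap_nhds_zero, Filter.mem_comap] at hV
      obtain ⟨U, hU, hUV⟩ := hV
      obtain ⟨c, hc, hcB⟩ :=
        ((Bornology.eventually_ne_cobounded (0 : k)).and (hbdd hU)).exists
      obtain ⟨N, hN⟩ := hcau c⁻¹ (inv_ne_zero hc)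
      refine ⟨N, fun m hm n hn => hUV ?_⟩
      obtain ⟨x, hx, hxe⟩ := hN n hn m hm
      obtain ⟨u, hu, rfl⟩ := hcB hx
      change s n - s m ∈ U
      rw [← hxe]
      simpa [smul_smul, hc] using hu
    obtain ⟨x, hx⟩ := cauchySeq_tendsto_of_complete hcs
    have hlim : ∀ a : k, a ≠ 0 → ∃ N, ∀ n ≥ N, s n - x ∈ a • B := by
      intro a ha
      obtain ⟨N, hN⟩ := hcau a ha
      refine ⟨N, fun n hn => (hsmul ha).2 fun m => ?_⟩
      have h1 : Tendsto (fun i => p m (s n - s i)) atTop (𝓝 (p m (s n - x))) :=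
        ((hp m).tendsto _).comp (tendsto_const_nhds.sub hx)
      refine le_of_tendsto h1 ?_
      filter_upwards [eventually_ge_atTop N] with i hi
      exact (hsmul ha).1 (hN n hn i hi) m
    refine ⟨x, ?_, hlim⟩
    obtain ⟨N, hN⟩ := hlim 1 one_ne_zero
    have h1 : s N - x ∈ Submodule.span k B := by
      refine Submodule.subset_span ?_
      simpa using hN N le_rfl
    simpa using Submodule.sub_mem _ (hs N) h1

theorem IsLocalFieldCharZero.summable_smul [IsTopologicalAddGroup L]
    (hk : IsLocalFieldCharZero k)
    (hcomplete : @CompleteSpace L (IsTopologicalAddGroup.rightUniformSpace L))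
    {p : ℕ → Seminorm k L} (hpc : ∀ m, IsConvexSeminorm k (p m))
    (hbasis : ∀ U ∈ 𝓝 (0 : L), ∃ m, {x | p m x < 1} ⊆ U) {ι : Type*} {c : ι → k}
    (hc : Summable c) {v : ι → L} {C : ℕ → ℝ} (hv : ∀ m i, p m (v i) ≤ C m) :
    Summable fun i => c i • v i := by
  classical
  let _ : UniformSpace L := IsTopologicalAddGroup.rightUniformSpace L
  have : IsUniformAddGroup L := isUniformAddGroup_of_addCommGroup
  rw [summable_iff_vanishing]
  intro U hU
  obtain ⟨m, hm⟩ := hbasis U hU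
  have hpos : 0 < |C m| + 1 := by positivity
  obtain ⟨s, hs⟩ := hk.exists_coeffBound_tail hc (ε := (1 / 2) / (|C m| + 1)) (by positivity)
  refine ⟨s, fun t hts => hm ?_⟩
  have h1 := (hpc m).sum_le (by positivity) hs hpos.le t (v := v)
    fun i _ => (hv m i).trans ((le_abs_self _).trans (by linarith))
  rw [div_mul_cancel₀ _ hpos.ne'] at h1
  change p m _ < 1
  refine lt_of_le_of_lt (le_trans (le_of_eq ?_) h1) (by norm_num)
  congr 1
  refine Finset.sum_congr rfl fun i hi => ?_
  rw [if_neg fun h => Finset.disjoint_left.1 hts hi h]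

end SeminormSeq

section Target

variable {k : Type*} [NontriviallyNormedField k]
variable {E : Type*} [AddCommGroup E] [Module k E] [TopologicalSpace E] [IsTopologicalAddGroup E]
  [ContinuousSMul k E]

theorem equicontinuous_of_forall_norm_le {ι : Type*} {U : Set E} (hU : U ∈ 𝓝 0)
    {x : ι → E →L[k] k} (hx : ∀ i, ∀ e ∈ U, ‖x i e‖ ≤ 1) :
    Equicontinuous (fun i => (x i : E → k)) := by
  refine equicontinuous_of_equicontinuousAt_zero (fun i => (x i : E →+ k)) ?_
  rw [Metric.equicontinuousAt_iff_right]
  intro ε hε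
  obtain ⟨d, hd0, hd⟩ := NormedField.exists_norm_lt k hε
  filter_upwards [(set_smul_mem_nhds_zero_iff (norm_pos_iff.1 hd0)).2 hU]
  rintro _ ⟨e, he, rfl⟩ i
  simp only [Function.comp, map_zero, dist_zero_left]
  change ‖x i (d • e)‖ < ε
  rw [map_smul, norm_smul]
  exact (mul_le_of_le_one_right hd0.le (hx i e he)).trans_lt hd

/-- A continuous linear map to a nuclear Fréchet space is nuclear if it is bounded on a
neighbourhood of zero. -/
theorem IsFN.isNuclearMap_of_bounded (hk : IsLocalFieldCharZero k)
    {L : Type*} [AddCommGroup L] [Module k L] [TopologicalSpace L] [IsTopologicalAddGroup L]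
    (hL : IsFN k L) (f : E →L[k] L) {U₀ : Set E} (hU₀ : U₀ ∈ 𝓝 0)
    (hf₀ : Bornology.IsVonNBounded k (f '' U₀)) : IsNuclearMap f := by
  have := hL.continuousSMul
  have := hL.t2
  obtain ⟨p, lam, l, hpc, hp, hmono, hbasis, H⟩ := hL.exists_seminorm_seq hk
  choose Λ hΛ0 hΛ using fun m => hk.exists_coeffBound (H m).summable
  have hμ : ∀ m : ℕ, ∃ μ : k, 0 < ‖μ‖ ∧ ‖μ‖ < (1 / 2 : ℝ) ^ m / (Λ m + 1) := fun m =>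
    NormedField.exists_norm_lt k (div_pos (by positivity) (by linarith [hΛ0 m]))
  choose μ hμ0 hμ using hμ
  have hμΛ : ∀ m, ‖μ m‖ * (Λ m + 1) ≤ (1 / 2 : ℝ) ^ m := fun m =>
    ((lt_div_iff₀ (by linarith [hΛ0 m])).1 (hμ m)).le
  have hμ1 : ∀ m, ‖μ m‖ ≤ (1 / 2 : ℝ) ^ m := fun m =>
    (le_mul_of_one_le_right (hμ0 m).le (by linarith [hΛ0 m])).trans (hμΛ m)
  set U : Set E := U₀ ∩ {e | p 1 (f e) < ‖μ 0‖ / 2} with hUdef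
  have hU : U ∈ 𝓝 0 := by
    refine Filter.inter_mem hU₀ ?_
    exact ((hp 1).comp f.continuous).continuousAt.eventually_lt continuousAt_const
      (by simpa using hμ0 0)
  let Q : ℕ → (E →L[k] L) → Prop := fun m r =>
    (∀ j, ∃ C, ∀ e ∈ U, p j (r e) ≤ C) ∧ ∀ e ∈ U, p (m + 1) (r e) ≤ ‖μ m‖ / 2
  have hQ0 : Q 0 f := by
    refine ⟨fun j => ?_, fun e he => le_of_lt he.2⟩
    have h1 : {x | p j x < 1} ∈ 𝓝 (0 : L) :=
      (hp j).continuousAt.eventually_lt continuousAt_const (by simp)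
    obtain ⟨c, hc, hc0⟩ := ((hf₀ h1).and (Bornology.eventually_ne_cobounded (0 : k))).exists
    refine ⟨‖c‖, fun e he => ?_⟩
    obtain ⟨x, hx, hxe⟩ := hc ⟨e, he.1, rfl⟩
    rw [← hxe]
    change p j (c • x) ≤ ‖c‖
    rw [map_smul_eq_mul]
    exact mul_le_of_le_one_right (norm_nonneg _) (le_of_lt hx)
  have step : ∀ (m : ℕ) (r : {r // Q m r}), ∃ r' : {r // Q (m + 1) r},
      HasFiniteExpansion U (p m) ((1 / 2 : ℝ) ^ m) (r.1 - r'.1) := by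
    rintro m ⟨r, hr, hrm⟩
    obtain ⟨C, hC⟩ := hr (m + 2 + 1)
    obtain ⟨h, hh, hrh⟩ := (H (m + 2)).exists_hasFiniteRankOn r hC
      (ε := min (‖μ m‖ / 2) (‖μ (m + 1)‖ / 2))
      (lt_min (half_pos (hμ0 _)) (half_pos (hμ0 _)))
    refine ⟨⟨r - h, fun j => ?_, fun e he => (hrh e he).trans (min_le_right _ _)⟩, ?_⟩
    · obtain ⟨C₁, hC₁⟩ := hr j
      obtain ⟨C₂, hC₂⟩ := hh.exists_seminorm_le (p j)
      exact ⟨C₁ + C₂, fun e he => (map_sub_le_add (p j) _ _).trans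
        (add_le_add (hC₁ e he) (hC₂ e he))⟩
    · have h1 : r - (r - h) = h := by abel
      have h2 : ∀ e ∈ U, p (m + 1) (h e) ≤ ‖μ m‖ := by
        intro e he
        have h3 : p (m + 1) (r e - h e) ≤ ‖μ m‖ / 2 :=
          (hmono (Nat.le_succ (m + 1)) _).trans ((hrh e he).trans (min_le_left _ _))
        have h4 := map_sub_le_add (p (m + 1)) (r e) (r e - h e)
        rw [sub_sub_cancel] at h4
        linarith [hrm e he]
      obtain ⟨ι, i, c, x, y, hc, hrest⟩ :=
        (H m).hasFiniteExpansion (hΛ0 m) (hΛ m) hh (norm_pos_iff.1 (hμ0 m)) h2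
      simp only [h1]
      exact ⟨ι, i, c, x, y, hc.mono (hμΛ m), hrest⟩
  choose g hg using step
  let R : ∀ m, {r // Q m r} := fun m => Nat.rec ⟨f, hQ0⟩ (fun n r => g n r) m
  choose ι hι c x y hc hx hy hsum using fun m => hg m (R m)
  have hR : ∀ m, g m (R m) = R (m + 1) := fun m => rfl
  simp only [hR] at hsum
  have hpartial : ∀ (e : E) (M : ℕ), ∑ m ∈ Finset.range M, ((R m).1 - (R (m + 1)).1) e =
      f e - (R M).1 e := by
    intro e M
    exact Finset.sum_range_sub' (fun m => (R m).1 e) M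
  have hbound : ∀ j, ∃ C, 0 ≤ C ∧ ∀ (m : ℕ) (i : ι m), p j (y m i) ≤ C := by
    intro j
    refine ⟨1 + ∑ m ∈ Finset.range j, ∑ i, p j (y m i), ?_, fun m i => ?_⟩
    · exact add_nonneg zero_le_one
        (Finset.sum_nonneg fun m _ => Finset.sum_nonneg fun i _ => apply_nonneg _ _)
    · have h0 : 0 ≤ ∑ m ∈ Finset.range j, ∑ i, p j (y m i) :=
        Finset.sum_nonneg fun m _ => Finset.sum_nonneg fun i _ => apply_nonneg _ _
      rcases lt_or_ge m j with h | h
      · have h1 : p j (y m i) ≤ ∑ i, p j (y m i) :=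
          Finset.single_le_sum (f := fun i => p j (y m i)) (fun _ _ => apply_nonneg _ _)
            (Finset.mem_univ i)
        have h2 := Finset.single_le_sum (f := fun m => ∑ i, p j (y m i))
          (fun m _ => Finset.sum_nonneg fun i _ => apply_nonneg _ _) (Finset.mem_range.2 h)
        linarith
      · have h1 := (hmono h (y m i)).trans (hy m i)
        linarith
  choose C hC0 hC using hbound
  have hcs : Summable fun i : Σ m, ι m => c i.1 i.2 :=
    hk.summable_sigma summable_geometric_two hc
  refine isNuclearMap_of_countable (ι := Σ m, ι m) (fun i => c i.1 i.2) (fun i => x i.1 i.2)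
    (fun i => y i.1 i.2) _ hcs (equicontinuous_of_forall_norm_le hU fun i => hx i.1 i.2)
    (isBanachDisc_of_seminorm_seq hL.complete hpc hp hbasis hC0) (fun i m => hC m i.1 i.2) ?_
  have key : ∀ e ∈ U, HasSum (fun i : Σ m, ι m => (c i.1 i.2 * x i.1 i.2 e) • y i.1 i.2) (f e) := by
    intro e he
    have hs : Summable fun i : Σ m, ι m => (c i.1 i.2 * x i.1 i.2 e) • y i.1 i.2 := by
      simp only [mul_smul]
      refine hk.summable_smul hL.complete hpc hbasis hcs (C := C) fun m i => ?_
      rw [map_smul_eq_mul]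
      exact (mul_le_of_le_one_left (apply_nonneg _ _) (hx i.1 i.2 e he)).trans (hC m i.1 i.2)
    obtain ⟨a, ha⟩ := hs
    have h1 : HasSum (fun m => ((R m).1 - (R (m + 1)).1) e) a :=
      ha.sigma fun m => by rw [hsum m e]; exact hasSum_fintype _
    have h2 := h1.tendsto_sum_nat
    simp only [hpartial] at h2
    have h3 : Tendsto (fun M => (R M).1 e) atTop (𝓝 0) := by
      rw [Filter.tendsto_def]
      intro V hV
      obtain ⟨j, hj⟩ := hbasis V hV
      filter_upwards [eventually_ge_atTop j] with M hM
      refine hj (lt_of_le_of_lt ((hmono (hM.trans (Nat.le_succ M)) _).trans ((R M).2.2 e he)) ?_)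
      have := (hμ1 M).trans (pow_le_one₀ (by norm_num) (by norm_num))
      linarith
    have h4 : Tendsto (fun M => f e - (R M).1 e) atTop (𝓝 (f e)) := by
      simpa using tendsto_const_nhds.sub h3
    rwa [tendsto_nhds_unique h4 h2]
  intro e
  obtain ⟨a, ha, ha0⟩ := ((absorbent_nhds_zero (𝕜 := k) hU e).and
    (Bornology.eventually_ne_cobounded (0 : k))).exists
  obtain ⟨u, hu, rfl⟩ := ha (Set.mem_singleton e)
  have h1 := (key u hu).const_smul a
  simpa [smul_smul, mul_left_comm] using h1

end Target

section TateMaps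

variable {k : Type*} [NontriviallyNormedField k]
variable {L : Type*} [AddCommGroup L] [Module k L] [TopologicalSpace L] [IsTopologicalAddGroup L]
variable {G : Type*} [AddCommGroup G] [Module k G] [TopologicalSpace G]

theorem IsFN.isNuclearMap_to_dfn (hk : IsLocalFieldCharZero k) (hL : IsFN k L) (hG : IsDFN k G)
    (f : L →L[k] G) : IsNuclearMap f := by
  obtain ⟨F, _, _, _, _, hF, ⟨e⟩⟩ := hG
  have := hk.completeSpace
  have := hL.firstCountable
  have := hF.firstCountable
  have := hF.continuousSMul
  let f' : L →L[k] StrongDual k F := (e : G →L[k] StrongDual k F) ∘L f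
  obtain ⟨U, hU, hfU⟩ := hF.exists_bounded_image_to_dual f'
  have hn : IsNuclearMap f' := isNuclearMap_of_isNuclearSpace hL.nuclear hL.locallyConvex f' hU hfU
  have : f = (e.symm : StrongDual k F →L[k] G) ∘L f' := by ext x; simp [f']
  rw [this]
  exact hn.comp_left _

theorem IsDFN.isNuclearMap_to_fn (hk : IsLocalFieldCharZero k) (hG : IsDFN k G) (hL : IsFN k L)
    (f : G →L[k] L) : IsNuclearMap f := by
  obtain ⟨F, _, _, _, _, hF, ⟨e⟩⟩ := hG
  have := hL.firstCountable
  have := hL.continuousSMul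
  have := hF.firstCountable
  have := hF.continuousSMul
  let f' : StrongDual k F →L[k] L := f ∘L (e.symm : StrongDual k F →L[k] G)
  obtain ⟨U, hU, hfU⟩ := exists_bounded_image_of_dual f'
  have hn : IsNuclearMap f' := hL.isNuclearMap_of_bounded hk f' hU hfU
  have : f = f' ∘L (e : G →L[k] StrongDual k F) := by ext x; simp [f']
  rw [this]
  exact hn.comp_right _

end TateMaps

namespace Decomposition

variable {k : Type*} [NontriviallyNormedField k]
variable {V : Type*} [AddCommGroup V] [Module k V] [TopologicalSpace V] [IsTopologicalAddGroup V]

theorem projPlus_add_projMinus (D : Decomposition k V) (x : V) :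
    (D.projPlus x : V) + D.projMinus x = x :=
  Submodule.projection_add_projection_eq_self D.isTopCompl.isCompl x

/-- Exchanging the two summands. -/
def swap (D : Decomposition k V) : Decomposition k V := ⟨D.minus, D.plus, D.isTopCompl.symm⟩

theorem Equivalent.symm {D E : Decomposition k V} (h : D.Equivalent E) : E.Equivalent D :=
  ⟨h.2.2.1, h.2.2.2, h.1, h.2.1⟩

/-- If the off-diagonal component of `g` for `D` is nuclear, so is the one from `A₊` to `B₋` for
equivalent decompositions `A` and `B`. -/
theorem isNuclearMap_component {A B D : Decomposition k V} (g : V →L[k] V)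
    (hA : IsNuclearMap (D.projMinus ∘L A.plus.subtypeL))
    (hB : IsNuclearMap (B.projMinus ∘L D.plus.subtypeL))
    (hD : IsNuclearMap (D.projMinus ∘L g ∘L D.plus.subtypeL)) :
    IsNuclearMap (B.projMinus ∘L g ∘L A.plus.subtypeL) := by
  have h1 := hA.comp_left (B.projMinus ∘L g ∘L D.minus.subtypeL)
  have h2 := hB.comp_right (D.projPlus ∘L g ∘L D.plus.subtypeL ∘L D.projPlus ∘L A.plus.subtypeL)
  have h3 := (hD.comp_right (D.projPlus ∘L A.plus.subtypeL)).comp_left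
    (B.projMinus ∘L D.minus.subtypeL)
  convert (h1.add h2).add h3 using 1
  ext x
  have e1 := D.projPlus_add_projMinus (x : V)
  have e2 := D.projPlus_add_projMinus (g (D.projPlus (x : V)))
  have e3 : B.projMinus (g x) = B.projMinus (g (D.projMinus (x : V))) +
      (B.projMinus (D.projPlus (g (D.projPlus (x : V)))) +
        B.projMinus (D.projMinus (g (D.projPlus (x : V))))) := by
    rw [← map_add, e2, ← map_add, ← map_add, add_comm, e1]
  rw [add_assoc]
  exact congrArg Subtype.val e3

theorem isNuclearMap_projMinus_trans {A D B : Decomposition k V}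
    (hAD : IsNuclearMap (D.projMinus ∘L A.plus.subtypeL))
    (hDB : IsNuclearMap (B.projMinus ∘L D.plus.subtypeL)) :
    IsNuclearMap (B.projMinus ∘L A.plus.subtypeL) := by
  have h1 := hAD.comp_left (B.projMinus ∘L D.minus.subtypeL)
  have h2 := hDB.comp_right (D.projPlus ∘L A.plus.subtypeL)
  convert h1.add h2 using 1
  ext x
  have e1 : B.projMinus (x : V) = B.projMinus (D.projMinus (x : V)) +
      B.projMinus (D.projPlus (x : V)) := by
    rw [← map_add, add_comm, D.projPlus_add_projMinus]
  exact congrArg Subtype.val e1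

theorem Equivalent.trans {A D B : Decomposition k V} (hAD : A.Equivalent D)
    (hDB : D.Equivalent B) : A.Equivalent B :=
  ⟨isNuclearMap_projMinus_trans hAD.1 hDB.1,
    isNuclearMap_projMinus_trans (A := A.swap) (D := D.swap) (B := B.swap) hAD.2.1 hDB.2.1,
    isNuclearMap_projMinus_trans hDB.2.2.1 hAD.2.2.1,
    isNuclearMap_projMinus_trans (A := B.swap) (D := D.swap) (B := A.swap) hDB.2.2.2 hAD.2.2.2⟩

theorem IsTate.equivalent (hk : IsLocalFieldCharZero k) {D E : Decomposition k V} (hD : D.IsTate)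
    (hE : E.IsTate) : D.Equivalent E :=
  ⟨hD.1.isNuclearMap_to_dfn hk hE.2 _, hD.2.isNuclearMap_to_fn hk hE.1 _,
    hE.1.isNuclearMap_to_dfn hk hD.2 _, hE.2.isNuclearMap_to_fn hk hD.1 _⟩

theorem Equivalent.polarization_eq {D E : Decomposition k V} (h : D.Equivalent E) :
    D.polarization = E.polarization :=
  Set.ext fun _ => ⟨fun h' => h.symm.trans h', fun h' => h.trans h'⟩

theorem IsTate.glres_polarization (hk : IsLocalFieldCharZero k) {D : Decomposition k V}
    (hD : D.IsTate) : GLres D.polarization = Set.univ := by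
  refine Set.eq_univ_of_forall fun g E hE => ⟨?_, ?_⟩
  · exact isNuclearMap_component (g : V →L[k] V) hE.2.2.1 hE.1 (hD.1.isNuclearMap_to_dfn hk hD.2 _)
  · exact isNuclearMap_component (A := E.swap) (B := E.swap) (D := D.swap) (g : V →L[k] V)
      hE.2.2.2 hE.2.1 (hD.2.isNuclearMap_to_fn hk hD.1 _)

end Decomposition

end AnalyticTate

end

theorem mainTheorem5 {k : Type*} [NontriviallyNormedField k]
    (hk : AnalyticTate.IsLocalFieldCharZero k)
    {V : Type*} [AddCommGroup V] [Module k V] [TopologicalSpace V] [IsTopologicalAddGroup V]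
    [ContinuousSMul k V] (hV : AnalyticTate.IsAnalyticTateSpace k V) :
    (∀ D E : AnalyticTate.Decomposition k V, D.IsTate → E.IsTate → D.Equivalent E) ∧
    (∃! P : Set (AnalyticTate.Decomposition k V), AnalyticTate.IsTatePolarization P) ∧
    (∀ P : Set (AnalyticTate.Decomposition k V),
      AnalyticTate.IsTatePolarization P → AnalyticTate.GLres P = Set.univ) := by
  refine ⟨fun D E hD hE => hD.equivalent hk hE, ?_, ?_⟩
  · obtain ⟨-, D, hD⟩ := hV
    refine ⟨D.polarization, ⟨D, hD, rfl⟩, ?_⟩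
    rintro _ ⟨E, hE, rfl⟩
    exact (hE.equivalent hk hD).polarization_eq
  · rintro _ ⟨D, hD, rfl⟩
    exact hD.glres_polarization hk
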